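/- Let $k$ be a field of characteristic zero. For a Lie algebra $\mathfrak g$ over $k$ and a $\mathfrak g$-module $M$, let $\mathrm{Der}(\mathfrak g,M)$ be the space of $k$-linear maps $D:\mathfrak g\to M$ with $D([g,h])=g\circ D(h)-h\circ D(g)$, let $\mathrm{ad}(\mathfrak g,M)$ be the subspace of inner derivations $g\mapsto g\circ m$ ($m\in M$), let $\mathrm{AID}(\mathfrak g,M)$ be the subspace of those $D$ such that for every $g\in\mathfrak g$ there is $m\in M$ (possibly depending on $g$) with $D(g)=g\circ m$, and put $\mathrm{Out}(\mathfrak g,M)=\mathrm{Der}(\mathfrak g,M)/\mathrm{ad}(\mathfrak g,M)$ and $\mathrm{Sha}(\mathfrak g,M)=\mathrm{AID}(\mathfrak g,M)/\mathrm{ad}(\mathfrak g,M)$. Omit $M$ from the notation when $M=\mathfrak g$ with the adjoint action. Regard the universal enveloping algebra $U(\mathfrak g)$ as a $\mathfrak g$-module by $g\circ m=i(g)m-m\,i(g)$, where $i:\mathfrak g\to U(\mathfrak g)$ is the canonical map. Let $\mathfrak g$ be a finite-dimensional Lie algebra over $k$. Then: 1. If $m\in U(\mathfrak g)$ and $g\circ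 m\in i(\mathfrak g)$ for all $g\in\mathfrak g$, then there is $x\in\mathfrak g$ such that $m-i(x)$ lies in the centre of $U(\mathfrak g)$. 2. Composition with $i$, $D\mapsto i\circ D$, induces injective $k$-linear maps $\mathrm{Der}(\mathfrak g)\to\mathrm{Der}(\mathfrak g,U(\mathfrak g))$, $\mathrm{ad}(\mathfrak g)\to\mathrm{ad}(\mathfrak g,U(\mathfrak g))$, $\mathrm{Out}(\mathfrak g)\to\mathrm{Out}(\mathfrak g,U(\mathfrak g))$, $\mathrm{AID}(\mathfrak g)\to\mathrm{AID}(\mathfrak g,U(\mathfrak g))$ and $\mathrm{Sha}(\mathfrak g)\to \mathrm{Sha}(\mathfrak g,U(\mathfrak g))$. 3. If $\mathrm{Sha}(\mathfrak g)\ne 0$, then $\mathrm{Sha}(\mathfrak g,U(\mathfrak g))\ne 0$. Moreover, over every field $k$ of characteristic zero there exists a finite-dimensional Lie algebra $\mathfrak g$ with $\mathrm{Sha}(\mathfrak g,U(\mathfrak g))\ne 0$. -/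

import Mathlib

universe u v

namespace LieSha

section General

variable (k : Type*) (L : Type*) (M : Type*) [CommRing k] [LieRing L] [LieAlgebra k L]
  [AddCommGroup M] [Module k M] [LieRingModule L M] [LieModule k L M]

/-- `Der(L, M)`: the `k`-module of derivations `D : L → M`, that is, linear maps with
`D [g, h] = g ∘ D h - h ∘ D g`. -/
abbrev Der := LieDerivation k L M

/-- `ad(L, M)`: the inner derivations `g ↦ g ∘ m`, for `m ∈ M`. -/
def ad : Submodule k (Der k L M) := LinearMap.range (LieDerivation.inner k L M)

theorem mem_ad {D : Der k L M} : D ∈ ad k L M ↔ ∃ m : M, ∀ g : L, D g = ⁅g, m⁆ := by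
  constructor
  · rintro ⟨m, rfl⟩
    exact ⟨m, fun g => rfl⟩
  · rintro ⟨m, hm⟩
    exact ⟨m, LieDerivation.ext fun g => (hm g).symm⟩

/-- `Out(L, M) = Der(L, M) / ad(L, M)`. -/
abbrev Out := Der k L M ⧸ ad k L M

/-- `AID(L, M)`: the almost inner derivations, those `D` such that for every `g` there is
an `m`, possibly depending on `g`, with `D g = g ∘ m`. -/
def AID : Submodule k (Der k L M) where
  carrier := {D | ∀ g : L, ∃ m : M, D g = ⁅g, m⁆}
  zero_mem' g := ⟨0, by simp⟩
  add_mem' {D E} hD hE g := by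
    obtain ⟨m, hm⟩ := hD g
    obtain ⟨n, hn⟩ := hE g
    exact ⟨m + n, by simp [hm, hn]⟩
  smul_mem' c D hD g := by
    obtain ⟨m, hm⟩ := hD g
    exact ⟨c • m, by simp [hm]⟩

theorem mem_AID {D : Der k L M} : D ∈ AID k L M ↔ ∀ g : L, ∃ m : M, D g = ⁅g, m⁆ := Iff.rfl

theorem ad_le_AID : ad k L M ≤ AID k L M := fun _ hD g =>
  let ⟨m, hm⟩ := (mem_ad k L M).1 hD
  ⟨m, hm g⟩

/-- `Sha(L, M) = AID(L, M) / ad(L, M)`, where `ad(L, M)` is viewed as a submodule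
of `AID(L, M)`. -/
abbrev Sha := AID k L M ⧸ (ad k L M).submoduleOf (AID k L M)

end General

section Functoriality

variable {k : Type*} {L : Type*} {M N : Type*} [CommRing k] [LieRing L] [LieAlgebra k L]
  [AddCommGroup M] [Module k M] [LieRingModule L M] [LieModule k L M]
  [AddCommGroup N] [Module k N] [LieRingModule L N] [LieModule k L N]

/-- The map `Der(L, M) → Der(L, N)`, `D ↦ f ∘ D`, induced by a morphism `f : M → N` of
`L`-modules. -/
def derMap (f : M →ₗ⁅k,L⁆ N) : Der k L M →ₗ[k] Der k L N where
  toFun D :=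
    { toLinearMap := (f : M →ₗ[k] N) ∘ₗ D.toLinearMap
      leibniz' := fun a b => by simp }
  map_add' D E := by ext g; simp
  map_smul' c D := by ext g; simp

theorem derMap_apply (f : M →ₗ⁅k,L⁆ N) (D : Der k L M) (g : L) : derMap f D g = f (D g) := rfl

theorem derMap_mem_ad (f : M →ₗ⁅k,L⁆ N) {D : Der k L M} (hD : D ∈ ad k L M) :
    derMap f D ∈ ad k L N := by
  obtain ⟨m, hm⟩ := (mem_ad k L M).1 hD
  exact (mem_ad k L N).2 ⟨f m, fun g => by rw [derMap_apply, hm, LieModuleHom.map_lie]⟩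

theorem derMap_mem_AID (f : M →ₗ⁅k,L⁆ N) {D : Der k L M} (hD : D ∈ AID k L M) :
    derMap f D ∈ AID k L N := by
  intro g
  obtain ⟨m, hm⟩ := hD g
  exact ⟨f m, by rw [derMap_apply, hm, LieModuleHom.map_lie]⟩

/-- The restriction `ad(L, M) → ad(L, N)` of `derMap f`. -/
def adMap (f : M →ₗ⁅k,L⁆ N) : ad k L M →ₗ[k] ad k L N :=
  (derMap f).restrict fun _ hD => derMap_mem_ad f hD

/-- The map `Out(L, M) → Out(L, N)` induced by `derMap f` on quotients. -/
def outMap (f : M →ₗ⁅k,L⁆ N) : Out k L M →ₗ[k] Out k L N :=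
  (ad k L M).mapQ (ad k L N) (derMap f) fun _ hD => derMap_mem_ad f hD

/-- The restriction `AID(L, M) → AID(L, N)` of `derMap f`. -/
def aidMap (f : M →ₗ⁅k,L⁆ N) : AID k L M →ₗ[k] AID k L N :=
  (derMap f).restrict fun _ hD => derMap_mem_AID f hD

/-- The map `Sha(L, M) → Sha(L, N)` induced by `aidMap f` on quotients. -/
def shaMap (f : M →ₗ⁅k,L⁆ N) : Sha k L M →ₗ[k] Sha k L N :=
  ((ad k L M).submoduleOf (AID k L M)).mapQ ((ad k L N).submoduleOf (AID k L N)) (aidMap f)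
    fun _ hD => derMap_mem_ad f hD

end Functoriality

section Enveloping

variable (k : Type*) (L : Type*) [CommRing k] [LieRing L] [LieAlgebra k L]

open UniversalEnvelopingAlgebra (ι)

/-- The adjoint action of `L` on `U(L)`: `g ∘ m = g m - m g`. -/
instance instLieRingModuleU : LieRingModule L (UniversalEnvelopingAlgebra k L) where
  bracket g m := ι k g * m - m * ι k g
  add_lie g h m := by simp only [map_add, add_mul, mul_add]; abel
  lie_add g m n := by simp only [add_mul, mul_add]; abel
  leibniz_lie g h m := by
    let _ : LieRing (UniversalEnvelopingAlgebra k L) := LieRing.ofAssociativeRing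
    have e : ι k ⁅g, h⁆ = ι k g * ι k h - ι k h * ι k g := LieHom.map_lie (ι k) g h
    simp only [e, sub_mul, mul_sub, mul_assoc]
    abel

theorem lie_U_def (g : L) (m : UniversalEnvelopingAlgebra k L) :
    ⁅g, m⁆ = ι k g * m - m * ι k g := rfl

instance instLieModuleU : LieModule k L (UniversalEnvelopingAlgebra k L) where
  smul_lie c g m := by simp only [lie_U_def, map_smul, smul_mul_assoc, mul_smul_comm, smul_sub]
  lie_smul c g m := by simp only [lie_U_def, smul_mul_assoc, mul_smul_comm, smul_sub]

/-- The canonical map `i : L → U(L)`, as a morphism from the adjoint `L`-module to `U(L)`. -/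
def toU : L →ₗ⁅k,L⁆ UniversalEnvelopingAlgebra k L where
  toFun := ι k
  map_add' x y := map_add _ x y
  map_smul' c x := map_smul _ c x
  map_lie' {x y} := by
    let _ : LieRing (UniversalEnvelopingAlgebra k L) := LieRing.ofAssociativeRing
    exact LieHom.map_lie (ι k) x y

theorem toU_apply (x : L) : toU k L x = ι k x := rfl

end Enveloping

end LieSha

/-!
All assertions about `U(L)` follow from an `L`-equivariant linear retraction `r` of the canonical
map `i : L → U(L)` (`exists_retraction`). Composition with `r` is a left inverse of each of the five
induced maps; and if `[g, m] ∈ i(L)` for all `g`, then `[g, m - i (r m)] = 0` for all `g`, so that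
`m - i (r m)` is central, because `L` generates `U(L)`.

The existence of `r` contains the injectivity of `i`, so something of the strength of the
Poincaré–Birkhoff–Witt theorem is needed. In characteristic zero it can be had from formal group
theory. In exponential coordinates the left-invariant vector field of `x ∈ L` is
`Y ↦ b(ad Y) x`, where `b(s) = s / (1 - exp (-s))`. These formal vector fields form a
representation of `L` by the Maurer–Cartan equation (`sum_bernCoeff_derivation`), a purely
algebraic identity between power series in `ad Y`. Hence `U(L)` acts on formal functions, and
`r u` is the value at the origin of `u` applied to the identity map of `L`
(`retraction`). As the value of the field of `x` at the origin is `x`, one has `r (i x) = x`. The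
vector field `Y ↦ [x, Y]` of the adjoint action normalises the left-invariant fields and vanishes
at the origin, which gives the equivariance.

Formal vector fields are infinite sums of homogeneous polynomial ones. They are handled as Laurent
series of operators on polynomials, the exponent being the degree of the operator; no completion of
the polynomial ring is then needed.

For the last assertion it remains to exhibit an almost inner derivation that is not inner, and the
filiform Lie algebra of dimension five has one (`Filiform.outerDer`).
-/

namespace LieSha

open Finset.HasAntidiagonal (antidiagonal mem_antidiagonal)
open scoped TensorProduct
open MvPolynomial (X)

/-! ### The Maurer–Cartan equation for iterated adjoint maps -/

section FormalIdentity

variable {k : Type*} [Field k]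

/-- The coefficients of `(1 - exp (-s)) / s`. -/
def expQuot (k : Type*) [Field k] (n : ℕ) : k := (-1) ^ n / ((n + 1).factorial : k)

/-- The coefficients of the Bernoulli series `s / (1 - exp (-s))`. -/
noncomputable def bernCoeff (k : Type*) [Field k] (n : ℕ) : k :=
  PowerSeries.coeff n (PowerSeries.mk (expQuot k))⁻¹

theorem expQuot_zero : expQuot k 0 = 1 := by simp [expQuot]

theorem sum_expQuot_mul_bernCoeff (n : ℕ) :
    ∑ ij ∈ antidiagonal n, expQuot k ij.1 * bernCoeff k ij.2 = if n = 0 then 1 else 0 := by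
  have h : PowerSeries.mk (expQuot k) * (PowerSeries.mk (expQuot k))⁻¹ = 1 :=
    PowerSeries.mul_inv_cancel _ (by simp [← PowerSeries.coeff_zero_eq_constantCoeff_apply,
      expQuot_zero])
  have h' := congrArg (PowerSeries.coeff n) h
  rw [PowerSeries.coeff_mul, PowerSeries.coeff_one] at h'
  simpa [bernCoeff] using h'

theorem bernCoeff_zero : bernCoeff k 0 = 1 := by
  simpa [expQuot_zero] using sum_expQuot_mul_bernCoeff (k := k) 0

/-- The identity of coefficients behind
`exp (-(s + t)) - exp (-s) - exp (-t) + 1 = (1 - exp (-s)) * (1 - exp (-t))`. -/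
theorem expQuot_mul_choose [CharZero k] {m : ℕ} {pq : ℕ × ℕ} (h : pq ∈ antidiagonal m) :
    expQuot k (m + 1) * ((m + 2).choose (pq.1 + 1) : k) = -(expQuot k pq.1 * expQuot k pq.2) := by
  obtain ⟨p, q⟩ := pq
  obtain rfl : p + q = m := by simpa using h
  have h1 := Nat.choose_mul_factorial_mul_factorial (show p + 1 ≤ p + q + 2 by omega)
  rw [show p + q + 2 - (p + 1) = q + 1 by omega] at h1
  have h2 : ((p + q + 2).choose (p + 1) : k) * (p + 1).factorial * (q + 1).factorial =
      (p + q + 2).factorial := by exact_mod_cast h1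
  have h3 : ((p + 1).factorial : k) ≠ 0 := by exact_mod_cast Nat.factorial_ne_zero _
  have h4 : ((q + 1).factorial : k) ≠ 0 := by exact_mod_cast Nat.factorial_ne_zero _
  have h5 : ((p + q + 2).factorial : k) ≠ 0 := by exact_mod_cast Nat.factorial_ne_zero _
  simp only [expQuot]
  rw [show p + q + 1 + 1 = p + q + 2 by ring]
  field_simp
  rw [← h2]
  ring

theorem sum_antidiagonal_assoc {M : Type*} [AddCommMonoid M] (f : ℕ → ℕ → ℕ → M) (n : ℕ) :
    ∑ x ∈ antidiagonal n, ∑ y ∈ antidiagonal x.1, f y.1 y.2 x.2 =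
      ∑ x ∈ antidiagonal n, ∑ y ∈ antidiagonal x.2, f x.1 y.1 y.2 := by
  rw [Finset.sum_sigma', Finset.sum_sigma']
  refine Finset.sum_nbij' (fun s => ⟨(s.2.1, s.2.2 + s.1.2), (s.2.2, s.1.2)⟩)
    (fun s => ⟨(s.1.1 + s.2.1, s.2.2), (s.1.1, s.2.1)⟩) ?_ ?_ ?_ ?_ ?_ <;>
  · rintro ⟨⟨a, b⟩, ⟨c, d⟩⟩ h
    obtain ⟨rfl, rfl⟩ : a + b = n ∧ _ := by simpa only [Finset.mem_sigma, mem_antidiagonal] using h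
    simp [add_assoc]

theorem sum_antidiagonal_left_comm {M : Type*} [AddCommMonoid M] (f : ℕ → ℕ → ℕ → M) (n : ℕ) :
    ∑ x ∈ antidiagonal n, ∑ y ∈ antidiagonal x.2, f x.1 y.1 y.2 =
      ∑ x ∈ antidiagonal n, ∑ y ∈ antidiagonal x.2, f y.1 x.1 y.2 := by
  rw [← sum_antidiagonal_assoc, ← sum_antidiagonal_assoc (fun a b c => f b a c)]
  refine Finset.sum_congr rfl fun x _ => ?_
  rw [← Finset.Nat.sum_antidiagonal_swap]
  rfl

theorem sum_antidiagonal_exchange {M : Type*} [AddCommMonoid M] (f : ℕ → ℕ → ℕ → ℕ → M) (n : ℕ) :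
    ∑ x ∈ antidiagonal n, ∑ y ∈ antidiagonal x.1, ∑ z ∈ antidiagonal x.2, f y.1 y.2 z.1 z.2 =
      ∑ x ∈ antidiagonal n, ∑ y ∈ antidiagonal x.1, ∑ z ∈ antidiagonal x.2, f y.1 z.1 y.2 z.2 := by
  rw [sum_antidiagonal_assoc (fun a b c => ∑ z ∈ antidiagonal c, f a b z.1 z.2),
    sum_antidiagonal_assoc (fun a b c => ∑ z ∈ antidiagonal c, f a z.1 b z.2)]
  refine Finset.sum_congr rfl fun x _ => ?_
  exact sum_antidiagonal_left_comm (fun b c d => f x.1 b c d) x.2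

variable {G : Type*} [LieRing G] [LieAlgebra k G]

theorem ad_pow_succ_apply (Y v : G) (n : ℕ) :
    ((LieAlgebra.ad k G Y) ^ (n + 1)) v = ⁅Y, ((LieAlgebra.ad k G Y) ^ n) v⁆ := by
  rw [pow_succ']; rfl

/-- The exterior derivative of `(ad Y) ^ (m + 1)`: if two derivations move `Y` to `v` and to `w`,
the antisymmetrised commutators of these derivations with `(ad Y) ^ (m + 1)` only involve brackets
of iterated `ad Y` of `v` and `w`. The binomial coefficients arise from Pascal's rule. -/
theorem derivation_ad_pow (d e : LieDerivation k G G) (Y v w : G) (hv : d Y = v) (hw : e Y = w)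
    (m : ℕ) :
    (e (((LieAlgebra.ad k G Y) ^ (m + 1)) v) - ((LieAlgebra.ad k G Y) ^ (m + 1)) (e v)) -
      (d (((LieAlgebra.ad k G Y) ^ (m + 1)) w) - ((LieAlgebra.ad k G Y) ^ (m + 1)) (d w)) =
    -∑ pq ∈ antidiagonal m, ((m + 2).choose (pq.1 + 1) : k) •
      ⁅((LieAlgebra.ad k G Y) ^ pq.1) v, ((LieAlgebra.ad k G Y) ^ pq.2) w⁆ := by
  induction m with
  | zero =>
    simp [hv, hw]
    rw [← lie_skew v w, two_smul]; abel
  | succ m ih =>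
    have key : (e (((LieAlgebra.ad k G Y) ^ (m + 2)) v) -
          ((LieAlgebra.ad k G Y) ^ (m + 2)) (e v)) -
        (d (((LieAlgebra.ad k G Y) ^ (m + 2)) w) - ((LieAlgebra.ad k G Y) ^ (m + 2)) (d w)) =
      ⁅Y, (e (((LieAlgebra.ad k G Y) ^ (m + 1)) v) -
          ((LieAlgebra.ad k G Y) ^ (m + 1)) (e v)) -
        (d (((LieAlgebra.ad k G Y) ^ (m + 1)) w) - ((LieAlgebra.ad k G Y) ^ (m + 1)) (d w))⁆
      - (⁅((LieAlgebra.ad k G Y) ^ (m + 1)) v, w⁆ +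
          ⁅v, ((LieAlgebra.ad k G Y) ^ (m + 1)) w⁆) := by
      simp only [ad_pow_succ_apply _ _ (m + 1), LieDerivation.apply_lie_eq_add, hv, hw, lie_sub]
      rw [← lie_skew w]
      abel
    rw [key, ih, lie_neg, lie_sum]
    have h1 : ∑ pq ∈ antidiagonal (m + 1), ((m + 1 + 2).choose (pq.1 + 1) : k) •
        ⁅((LieAlgebra.ad k G Y) ^ pq.1) v, ((LieAlgebra.ad k G Y) ^ pq.2) w⁆ =
      ∑ pq ∈ antidiagonal (m + 1), ((m + 2).choose pq.1 : k) •
        ⁅((LieAlgebra.ad k G Y) ^ pq.1) v, ((LieAlgebra.ad k G Y) ^ pq.2) w⁆ +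
      ∑ pq ∈ antidiagonal (m + 1), ((m + 2).choose (pq.1 + 1) : k) •
        ⁅((LieAlgebra.ad k G Y) ^ pq.1) v, ((LieAlgebra.ad k G Y) ^ pq.2) w⁆ := by
      rw [← Finset.sum_add_distrib]
      refine Finset.sum_congr rfl fun pq _ => ?_
      rw [← add_smul, Nat.choose_succ_succ, Nat.cast_add]
    rw [h1, Finset.Nat.sum_antidiagonal_succ, Finset.Nat.sum_antidiagonal_succ']
    simp only [lie_smul, leibniz_lie Y, ← ad_pow_succ_apply, smul_add, Finset.sum_add_distrib,
      Nat.choose_zero_right, Nat.choose_self, Nat.cast_one, one_smul, pow_zero,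
      Module.End.one_apply]
    have e : ∀ A B c d : G, -(A + B) - (c + d) = -(d + A + (c + B)) := fun A B c d => by abel
    exact e _ _ _ _

/-- The Maurer–Cartan equation, in degree `n`. With `θ = ad Y` and `b` the Bernoulli series, the
vector fields `v = b(θ) x` and `u = b(θ) z` satisfy `T_v u - T_u v = b(θ) [x, z]`. Both sides are
compared after applying the inverse series `(1 - exp (-θ)) / θ`, whose derivative is controlled by
`derivation_ad_pow`. -/
theorem sum_bernCoeff_derivation [CharZero k] (T : G → LieDerivation k G G) (Y x z : G)
    (hY : ∀ v, T v Y = v) (hx : ∀ v, T v x = 0) (hz : ∀ v, T v z = 0) (n : ℕ) :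
    ∑ ij ∈ antidiagonal (n + 1),
      (T (bernCoeff k ij.1 • ((LieAlgebra.ad k G Y) ^ ij.1) x)
          (bernCoeff k ij.2 • ((LieAlgebra.ad k G Y) ^ ij.2) z) -
        T (bernCoeff k ij.2 • ((LieAlgebra.ad k G Y) ^ ij.2) z)
          (bernCoeff k ij.1 • ((LieAlgebra.ad k G Y) ^ ij.1) x)) =
      bernCoeff k n • ((LieAlgebra.ad k G Y) ^ n) ⁅x, z⁆ := by
  set θ := LieAlgebra.ad k G Y with hθ
  set v : ℕ → G := fun i => bernCoeff k i • (θ ^ i) x with hv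
  set u : ℕ → G := fun i => bernCoeff k i • (θ ^ i) z with hu
  -- `(1 - exp (-θ)) / θ` inverts the Bernoulli series.
  have hW : ∀ (y : G) (m : ℕ), ∑ ij ∈ antidiagonal m,
      expQuot k ij.1 • (θ ^ ij.1) (bernCoeff k ij.2 • (θ ^ ij.2) y) =
        if m = 0 then y else 0 := by
    intro y m
    have : ∀ ij ∈ antidiagonal m, expQuot k ij.1 • (θ ^ ij.1) (bernCoeff k ij.2 • (θ ^ ij.2) y) =
        (expQuot k ij.1 * bernCoeff k ij.2) • (θ ^ m) y := by
      intro ij h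
      rw [map_smul, smul_smul, ← Module.End.mul_apply, ← pow_add, mem_antidiagonal.1 h]
    rw [Finset.sum_congr rfl this, ← Finset.sum_smul, sum_expQuot_mul_bernCoeff]
    split_ifs with h <;> simp [h]
  set H : ℕ → ℕ → G := fun i j => T (v i) (u j) - T (u j) (v i) with hH
  -- Applying `(1 - exp (-θ)) / θ` to `T_v u - T_u v` leaves `[x, z]`, in degree `1` only.
  have hS : ∀ n, ∑ a ∈ antidiagonal (n + 1), ∑ jl ∈ antidiagonal a.2,
      expQuot k a.1 • (θ ^ a.1) (H jl.1 jl.2) = if n = 0 then ⁅x, z⁆ else 0 := by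
    intro n
    -- Commute `θ ^ i` past the two derivations; the terms with `θ ^ i` inside vanish by `hW`.
    have hsplit : ∀ i j l, expQuot k i • (θ ^ i) (H j l) =
        T (v j) (expQuot k i • (θ ^ i) (u l)) - T (u l) (expQuot k i • (θ ^ i) (v j)) +
        expQuot k i • ((T (u l) ((θ ^ i) (v j)) - (θ ^ i) (T (u l) (v j))) -
          (T (v j) ((θ ^ i) (u l)) - (θ ^ i) (T (v j) (u l)))) := by
      intro i j l
      simp only [hH, map_sub, map_smul, smul_sub]
      abel
    simp only [hsplit, Finset.sum_add_distrib, Finset.sum_sub_distrib]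
    have e1 : ∑ a ∈ antidiagonal (n + 1), ∑ jl ∈ antidiagonal a.2,
        T (v jl.1) (expQuot k a.1 • (θ ^ a.1) (u jl.2)) = 0 := by
      rw [sum_antidiagonal_left_comm (fun i j l => T (v j) (expQuot k i • (θ ^ i) (u l)))]
      refine Finset.sum_eq_zero fun a _ => ?_
      rw [← map_sum, hW]
      split_ifs <;> simp [hz]
    have e2 : ∑ a ∈ antidiagonal (n + 1), ∑ jl ∈ antidiagonal a.2,
        T (u jl.2) (expQuot k a.1 • (θ ^ a.1) (v jl.1)) = 0 := by
      rw [← sum_antidiagonal_assoc (fun i j l => T (u l) (expQuot k i • (θ ^ i) (v j)))]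
      refine Finset.sum_eq_zero fun a _ => ?_
      rw [← map_sum, hW]
      split_ifs <;> simp [hx]
    rw [e1, e2, sub_self, zero_add, Finset.Nat.sum_antidiagonal_succ]
    have e3 : ∀ m j l, expQuot k (m + 1) •
        ((T (u l) ((θ ^ (m + 1)) (v j)) - (θ ^ (m + 1)) (T (u l) (v j))) -
          (T (v j) ((θ ^ (m + 1)) (u l)) - (θ ^ (m + 1)) (T (v j) (u l)))) =
        ∑ pq ∈ antidiagonal m, ⁅expQuot k pq.1 • (θ ^ pq.1) (v j),
          expQuot k pq.2 • (θ ^ pq.2) (u l)⁆ := by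
      intro m j l
      rw [derivation_ad_pow (T (v j)) (T (u l)) Y _ _ (hY _) (hY _), smul_neg, Finset.smul_sum,
        ← Finset.sum_neg_distrib]
      refine Finset.sum_congr rfl fun pq h => ?_
      rw [smul_smul, expQuot_mul_choose h, neg_smul, neg_neg, smul_lie, lie_smul, smul_smul]
    simp only [e3, pow_zero, Module.End.one_apply, sub_self, smul_zero,
      Finset.sum_const_zero, zero_add]
    have e4 : ∑ a ∈ antidiagonal n, ∑ jl ∈ antidiagonal a.2, ∑ pq ∈ antidiagonal a.1,
        ⁅expQuot k pq.1 • (θ ^ pq.1) (v jl.1), expQuot k pq.2 • (θ ^ pq.2) (u jl.2)⁆ =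
        ∑ a ∈ antidiagonal n, ⁅(if a.1 = 0 then x else 0 : G), (if a.2 = 0 then z else 0 : G)⁆ := by
      calc _ = ∑ a ∈ antidiagonal n, ∑ y ∈ antidiagonal a.1, ∑ z ∈ antidiagonal a.2,
            ⁅expQuot k y.1 • (θ ^ y.1) (v z.1), expQuot k y.2 • (θ ^ y.2) (u z.2)⁆ :=
            Finset.sum_congr rfl fun a _ => Finset.sum_comm
        _ = ∑ a ∈ antidiagonal n, ∑ y ∈ antidiagonal a.1, ∑ z ∈ antidiagonal a.2,
            ⁅expQuot k y.1 • (θ ^ y.1) (v y.2), expQuot k z.1 • (θ ^ z.1) (u z.2)⁆ :=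
            sum_antidiagonal_exchange (fun p q j l =>
              ⁅expQuot k p • (θ ^ p) (v j), expQuot k q • (θ ^ q) (u l)⁆) n
        _ = _ := by
            refine Finset.sum_congr rfl fun a _ => ?_
            rw [← hW x a.1, ← hW z a.2, sum_lie]
            exact Finset.sum_congr rfl fun y _ => (lie_sum _ _ _).symm
    rw [e4]
    cases n with
    | zero => simp
    | succ n =>
      rw [if_neg n.succ_ne_zero]
      refine Finset.sum_eq_zero fun a ha => ?_
      have := mem_antidiagonal.1 ha
      split_ifs <;> first | omega | simp
  set D : ℕ → G := fun n => ∑ ij ∈ antidiagonal n, H ij.1 ij.2 with hD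
  have hD0 : D 0 = 0 := by simp [hD, hH, hv, hu, hx, hz]
  -- The difference of the two sides is killed by the invertible series `(1 - exp (-θ)) / θ`.
  have hF : ∀ n, ∑ a ∈ antidiagonal n, expQuot k a.1 • (θ ^ a.1)
      (D (a.2 + 1) - bernCoeff k a.2 • (θ ^ a.2) ⁅x, z⁆) = 0 := by
    intro n
    simp only [map_sub, smul_sub, Finset.sum_sub_distrib]
    rw [hW, sub_eq_zero, ← hS n, Finset.Nat.sum_antidiagonal_succ']
    simp only [← Finset.smul_sum, ← map_sum]
    change _ = expQuot k (n + 1) • (θ ^ (n + 1)) (D 0) + _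
    rw [hD0, map_zero, smul_zero, zero_add]
  have hmain : ∀ n, D (n + 1) - bernCoeff k n • (θ ^ n) ⁅x, z⁆ = 0 := by
    intro n
    induction n using Nat.strong_induction_on with
    | _ n ih =>
      have h := hF n
      rw [Finset.sum_eq_single (0, n)] at h
      · simpa [expQuot_zero] using h
      · rintro ⟨a, b⟩ hab hne
        have h1 := mem_antidiagonal.1 hab
        have h2 : b < n := by
          by_contra hb
          exact hne (by ext <;> simp at h1 ⊢ <;> omega)
        rw [ih b h2, map_zero, smul_zero]
      · intro hn
        exact absurd (mem_antidiagonal.2 (zero_add n)) hn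
  exact sub_eq_zero.1 (hmain n)

end FormalIdentity

/-! ### Polynomial vector fields on a Lie algebra -/

section Derivations

/-- A derivation `d` with `d Y = [x, Y]` and `d z = 0` differs from `ad x` by a derivation that
kills `Y`, hence commutes with `ad Y`. -/
theorem derivation_ad_pow_sub {k G : Type*} [Field k] [LieRing G] [LieAlgebra k G]
    (d : LieDerivation k G G) (Y x z : G) (hY : d Y = ⁅x, Y⁆) (hz : d z = 0) (n : ℕ) :
    d (((LieAlgebra.ad k G Y) ^ n) z) - ⁅x, ((LieAlgebra.ad k G Y) ^ n) z⁆ =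
      -((LieAlgebra.ad k G Y) ^ n) ⁅x, z⁆ := by
  induction n with
  | zero => simp [hz]
  | succ n ih =>
    rw [ad_pow_succ_apply, ad_pow_succ_apply, LieDerivation.apply_lie_eq_add, hY,
      leibniz_lie x, ← lie_neg, ← ih, lie_sub]
    abel

variable {k : Type*} [Field k] {L : Type*} [LieRing L] [LieAlgebra k L] {ι : Type*}

/-- A derivation `d` of a commutative `k`-algebra `R` acts on the Lie algebra `R ⊗ L` by the
derivation `d ⊗ 1`. -/
noncomputable def extendScalarsDer {R : Type*} [CommRing R] [Algebra k R]
    (d : Derivation k R R) : LieDerivation k (R ⊗[k] L) (R ⊗[k] L) where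
  toLinearMap := (d : R →ₗ[k] R).rTensor L
  leibniz' v w := by
    induction v with
    | zero => simp
    | add v v' h h' => simp only [add_lie, lie_add, map_add, h, h']; abel
    | tmul a x =>
      induction w with
      | zero => simp
      | add w w' h h' => simp only [add_lie, lie_add, map_add, h, h']; abel
      | tmul b y =>
        simp only [LieAlgebra.ExtendScalars.bracket_tmul, LinearMap.rTensor_tmul,
          Derivation.coeFn_coe, Derivation.leibniz, smul_eq_mul, TensorProduct.add_tmul]
        rw [← lie_skew x y, TensorProduct.tmul_neg, TensorProduct.tmul_neg, sub_eq_add_neg]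

@[simp]
theorem extendScalarsDer_tmul {R : Type*} [CommRing R] [Algebra k R] (d : Derivation k R R)
    (a : R) (x : L) : extendScalarsDer (L := L) d (a ⊗ₜ x) = d a ⊗ₜ[k] x := rfl

theorem extendScalarsDer_apply {R : Type*} [CommRing R] [Algebra k R] (d : Derivation k R R)
    (w : R ⊗[k] L) : extendScalarsDer d w = (d : R →ₗ[k] R).rTensor L w := rfl

variable (e : Module.Basis ι k L)

theorem baseChange_repr_extendScalarsDer {R : Type*} [CommRing R] [Algebra k R]
    (d : Derivation k R R) (w : R ⊗[k] L) (i : ι) :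
    (e.baseChange R).repr (extendScalarsDer d w) i = d ((e.baseChange R).repr w i) := by
  induction w with
  | zero => simp
  | add v w h h' => simp [h, h']
  | tmul a x => simp [Module.Basis.baseChange_repr_tmul]

/-- The vector field on the affine space `L` attached to a polynomial map `v : L → L`, as a
derivation of the polynomial ring. Polynomial maps `L → L` are encoded as elements of
`MvPolynomial ι k ⊗ L`, the variables being the coordinates in the basis `e`. -/
noncomputable def vectorField :
    MvPolynomial ι k ⊗[k] L →ₗ[k] Derivation k (MvPolynomial ι k) (MvPolynomial ι k) where
  toFun v := MvPolynomial.mkDerivation k fun i => (e.baseChange (MvPolynomial ι k)).repr v i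
  map_add' v w := MvPolynomial.derivation_ext fun i => by simp
  map_smul' c v := MvPolynomial.derivation_ext fun i => by
    rw [← algebraMap_smul (MvPolynomial ι k) c v]
    simp [MvPolynomial.algebraMap_eq, MvPolynomial.C_mul']

@[simp]
theorem vectorField_X (v : MvPolynomial ι k ⊗[k] L) (i : ι) :
    vectorField e v (X i) = (e.baseChange (MvPolynomial ι k)).repr v i :=
  MvPolynomial.mkDerivation_X _ _ _

/-- The action of `vectorField e v` on polynomial maps `L → L`. -/
noncomputable abbrev dirDeriv (v : MvPolynomial ι k ⊗[k] L) :
    LieDerivation k (MvPolynomial ι k ⊗[k] L) (MvPolynomial ι k ⊗[k] L) :=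
  extendScalarsDer (vectorField e v)

theorem dirDeriv_one_tmul (v : MvPolynomial ι k ⊗[k] L) (x : L) :
    dirDeriv e v (1 ⊗ₜ x) = 0 := by simp

theorem vectorField_commutator (v w : MvPolynomial ι k ⊗[k] L) (f : MvPolynomial ι k) :
    vectorField e v (vectorField e w f) - vectorField e w (vectorField e v f) =
      vectorField e (dirDeriv e v w - dirDeriv e w v) f := by
  rw [← Derivation.commutator_apply]
  refine DFunLike.congr_fun (MvPolynomial.derivation_ext fun i => ?_) f
  rw [Derivation.commutator_apply, vectorField_X, vectorField_X, vectorField_X, map_sub,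
    Finsupp.sub_apply, baseChange_repr_extendScalarsDer, baseChange_repr_extendScalarsDer]

variable (k L) in
/-- Evaluation at the origin of polynomial maps `L → L`. -/
noncomputable def evalZero (ι : Type*) : MvPolynomial ι k ⊗[k] L →ₗ[k] L :=
  TensorProduct.lid k L ∘ₗ (MvPolynomial.aeval (0 : ι → k)).toLinearMap.rTensor L

@[simp]
theorem evalZero_tmul (a : MvPolynomial ι k) (x : L) :
    evalZero k L ι (a ⊗ₜ x) = MvPolynomial.constantCoeff a • x := by
  simp [evalZero]

theorem evalZero_ad_one_tmul (x : L) (w : MvPolynomial ι k ⊗[k] L) :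
    evalZero k L ι (LieAlgebra.ad k _ (1 ⊗ₜ x) w) = ⁅x, evalZero k L ι w⁆ := by
  induction w with
  | zero => simp
  | add v w h h' => simp only [map_add, lie_add, h, h']
  | tmul a y => simp [LieAlgebra.ad_apply]

theorem constantCoeff_baseChange_repr (v : MvPolynomial ι k ⊗[k] L) (i : ι) :
    MvPolynomial.constantCoeff ((e.baseChange (MvPolynomial ι k)).repr v i) =
      e.repr (evalZero k L ι v) i := by
  induction v with
  | zero => simp
  | add v w h h' => simp [h, h']
  | tmul a x => simp [Module.Basis.baseChange_repr_tmul, mul_comm]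

theorem evalZero_dirDeriv {v : MvPolynomial ι k ⊗[k] L} (hv : evalZero k L ι v = 0)
    (w : MvPolynomial ι k ⊗[k] L) : evalZero k L ι (dirDeriv e v w) = 0 := by
  have h : ∀ f : MvPolynomial ι k, MvPolynomial.constantCoeff (vectorField e v f) = 0 := by
    intro f
    induction f using MvPolynomial.induction_on with
    | C a => simp
    | add p q hp hq => simp [hp, hq]
    | mul_X p i hp => simp [hp, constantCoeff_baseChange_repr, hv]
  induction w with
  | zero => simp
  | add v w h h' => simp [h, h']
  | tmul a x => simp [h]

variable [Fintype ι]

/-- The identity map of `L`, as an element of `k[L] ⊗ L`. -/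
noncomputable def idPoly : MvPolynomial ι k ⊗[k] L := ∑ i, X i ⊗ₜ e i

@[simp]
theorem evalZero_idPoly : evalZero k L ι (idPoly e) = 0 := by simp [idPoly]

theorem dirDeriv_idPoly (v : MvPolynomial ι k ⊗[k] L) : dirDeriv e v (idPoly e) = v := by
  rw [idPoly, map_sum]
  conv_rhs => rw [← (e.baseChange (MvPolynomial ι k)).sum_repr v]
  refine Finset.sum_congr rfl fun i _ => ?_
  simp [Module.Basis.baseChange_apply, TensorProduct.smul_tmul']

/-- The homogeneous component of degree `n` of the left-invariant vector field attached to `x`, in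
exponential coordinates: `b_n • (ad Y) ^ n x`, where `Y` is the identity map of `L` and `b_n` are
the coefficients of the Bernoulli series. -/
noncomputable def leftInv (n : ℕ) : L →ₗ[k] MvPolynomial ι k ⊗[k] L :=
  bernCoeff k n • ((LieAlgebra.ad k (MvPolynomial ι k ⊗[k] L) (idPoly e)) ^ n) ∘ₗ
    TensorProduct.mk k (MvPolynomial ι k) L 1

theorem leftInv_apply (n : ℕ) (x : L) : leftInv e n x =
    bernCoeff k n • ((LieAlgebra.ad k (MvPolynomial ι k ⊗[k] L) (idPoly e)) ^ n) (1 ⊗ₜ x) := rfl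

theorem leftInv_zero (x : L) : leftInv e 0 x = 1 ⊗ₜ x := by
  simp [leftInv_apply, bernCoeff_zero]

/-- The bracket of the left-invariant vector fields of `x` and `z` is that of `[x, z]`. -/
theorem sum_dirDeriv_leftInv [CharZero k] (x z : L) (n : ℕ) :
    ∑ ij ∈ antidiagonal (n + 1), (dirDeriv e (leftInv e ij.1 x) (leftInv e ij.2 z) -
      dirDeriv e (leftInv e ij.2 z) (leftInv e ij.1 x)) = leftInv e n ⁅x, z⁆ := by
  have := sum_bernCoeff_derivation (k := k) (dirDeriv e) (idPoly e) (1 ⊗ₜ x) (1 ⊗ₜ z)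
    (dirDeriv_idPoly e) (fun v => dirDeriv_one_tmul e v x) (fun v => dirDeriv_one_tmul e v z) n
  rw [LieAlgebra.ExtendScalars.bracket_tmul, one_mul] at this
  exact this

/-- The linear vector field `Y ↦ [x, Y]` of the adjoint action permutes the left-invariant ones. -/
theorem dirDeriv_ad_leftInv (x z : L) (n : ℕ) :
    dirDeriv e (LieAlgebra.ad k _ (1 ⊗ₜ x) (idPoly e)) (leftInv e n z) -
      dirDeriv e (leftInv e n z) (LieAlgebra.ad k _ (1 ⊗ₜ x) (idPoly e)) =
      -leftInv e n ⁅x, z⁆ := by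
  have h := derivation_ad_pow_sub (k := k)
    (dirDeriv e (LieAlgebra.ad k _ (1 ⊗ₜ x) (idPoly e))) (idPoly e) (1 ⊗ₜ x) (1 ⊗ₜ z)
    (dirDeriv_idPoly e _) (dirDeriv_one_tmul e _ z) n
  rw [LieAlgebra.ExtendScalars.bracket_tmul, one_mul] at h
  have h' : dirDeriv e (leftInv e n z) (LieAlgebra.ad k _ (1 ⊗ₜ x) (idPoly e)) =
      LieAlgebra.ad k _ (1 ⊗ₜ x) (leftInv e n z) := by
    rw [LieAlgebra.ad_apply, LieDerivation.apply_lie_eq_add, dirDeriv_one_tmul, zero_lie, add_zero,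
      dirDeriv_idPoly]
    rfl
  rw [h', leftInv_apply, leftInv_apply, map_smul, map_smul]
  exact (smul_sub _ _ _).symm.trans ((congrArg (bernCoeff k n • ·) h).trans (smul_neg _ _))

end Derivations

/-! ### Generation of the enveloping algebra by the Lie algebra -/

section Generation

attribute [local instance 100] LieRing.ofAssociativeRing

variable (k : Type*) (L : Type*) [CommRing k] [LieRing L] [LieAlgebra k L]

theorem adjoin_range_toU :
    Algebra.adjoin k (Set.range (UniversalEnvelopingAlgebra.ι k : L → _)) = ⊤ := by
  set S := Algebra.adjoin k (Set.range (UniversalEnvelopingAlgebra.ι k (L := L) : L → _))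
  let f : L →ₗ⁅k⁆ S :=
    { toFun := fun x => ⟨UniversalEnvelopingAlgebra.ι k x, Algebra.subset_adjoin ⟨x, rfl⟩⟩
      map_add' := fun x y => Subtype.ext (map_add _ x y)
      map_smul' := fun c x => Subtype.ext (map_smul _ c x)
      map_lie' := fun {x y} => Subtype.ext (LieHom.map_lie (UniversalEnvelopingAlgebra.ι k) x y) }
  have h : S.val.comp (UniversalEnvelopingAlgebra.lift k f) = AlgHom.id k _ := by
    refine UniversalEnvelopingAlgebra.hom_ext k (LieHom.ext fun x => ?_)
    change S.val (UniversalEnvelopingAlgebra.lift k f (UniversalEnvelopingAlgebra.ι k x)) = _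
    rw [UniversalEnvelopingAlgebra.lift_ι_apply]
    rfl
  rw [eq_top_iff]
  rintro u -
  have hu := DFunLike.congr_fun h u
  rw [AlgHom.id_apply] at hu
  rw [← hu]
  exact (UniversalEnvelopingAlgebra.lift k f u).2

variable {k L}

theorem lie_U_mul (x : L) (u v : UniversalEnvelopingAlgebra k L) :
    ⁅x, u * v⁆ = ⁅x, u⁆ * v + u * ⁅x, v⁆ := by
  simp only [lie_U_def]
  noncomm_ring

/-- `U(L)` is generated by `L`, so that its `L`-invariants are central. -/
theorem mem_center_of_lie_eq_zero {u : UniversalEnvelopingAlgebra k L}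
    (h : ∀ x : L, ⁅x, u⁆ = 0) :
    u ∈ Subalgebra.center k (UniversalEnvelopingAlgebra k L) := by
  rw [Subalgebra.mem_center_iff]
  intro a
  have ha : a ∈ Algebra.adjoin k (Set.range (UniversalEnvelopingAlgebra.ι k : L → _)) :=
    adjoin_range_toU k L ▸ Algebra.mem_top
  induction ha using Algebra.adjoin_induction with
  | mem _ hx =>
    obtain ⟨x, rfl⟩ := hx
    exact sub_eq_zero.1 (h x)
  | algebraMap r => exact Algebra.commutes r u
  | add a b _ _ ha hb => rw [add_mul, mul_add, ha, hb]
  | mul a b _ _ ha hb => rw [mul_assoc, hb, ← mul_assoc, ha, mul_assoc]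

/-- If an element `a` acts on the images of the generators of `U(L)` by the derivation `-ad x`, it
does so on the image of all of `U(L)`. -/
theorem algHom_commutator {A : Type*} [Ring A] [Algebra k A]
    (φ : UniversalEnvelopingAlgebra k L →ₐ[k] A) (a : A) (x : L)
    (h : ∀ z : L, a * φ (UniversalEnvelopingAlgebra.ι k z) -
      φ (UniversalEnvelopingAlgebra.ι k z) * a = -φ (UniversalEnvelopingAlgebra.ι k ⁅x, z⁆))
    (u : UniversalEnvelopingAlgebra k L) : a * φ u - φ u * a = -φ ⁅x, u⁆ := by
  have hu : u ∈ Algebra.adjoin k (Set.range (UniversalEnvelopingAlgebra.ι k : L → _)) :=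
    adjoin_range_toU k L ▸ Algebra.mem_top
  induction hu using Algebra.adjoin_induction with
  | mem _ hz =>
    obtain ⟨z, rfl⟩ := hz
    rw [h]
    exact congrArg (fun u => -φ u) (LieModuleHom.map_lie (toU k L) x z)
  | algebraMap r =>
    have h : ⁅x, algebraMap k (UniversalEnvelopingAlgebra k L) r⁆ = 0 :=
      sub_eq_zero.2 (Algebra.commutes r _).symm
    rw [h, map_zero, neg_zero, AlgHom.commutes, sub_eq_zero, Algebra.commutes]
  | add u v _ _ hu hv =>
    rw [lie_add, map_add, map_add, neg_add, ← hu, ← hv]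
    noncomm_ring
  | mul u v _ _ hu hv =>
    rw [lie_U_mul, map_add, map_mul, map_mul, map_mul, neg_add, ← neg_mul, ← mul_neg, ← hu, ← hv]
    noncomm_ring

end Generation

/-! ### The representation by left-invariant vector fields -/

section Representation

attribute [local instance 100] LieRing.ofAssociativeRing

variable {k : Type*} [Field k] {L : Type*} [LieRing L] [LieAlgebra k L] {ι : Type*}
  [Fintype ι] (e : Module.Basis ι k L)

/-- Laurent series of operators on polynomial functions. The exponent of the variable records by
how much an operator raises the degree: a vector field is an infinite sum of homogeneous
components, the first of which lowers degrees by one. -/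
abbrev FormalOp (k ι : Type*) [Field k] := LaurentSeries (Module.End k (MvPolynomial ι k))

/-- The left-invariant vector field attached to `x`, as a power series of operators whose `n`-th
coefficient is `vectorField e (leftInv e n x)`. -/
noncomputable def leftInvSeries :
    L →ₗ[k] PowerSeries (Module.End k (MvPolynomial ι k)) where
  toFun x := PowerSeries.mk fun n =>
    (vectorField e (leftInv e n x) : Module.End k (MvPolynomial ι k))
  map_add' x y := by ext n f; simp
  map_smul' c x := by
    ext1 n
    ext1 f
    simp

theorem coeff_leftInvSeries (x : L) (n : ℕ) : PowerSeries.coeff n (leftInvSeries e x) =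
    (vectorField e (leftInv e n x) : Module.End k (MvPolynomial ι k)) :=
  PowerSeries.coeff_mk n fun n =>
    (vectorField e (leftInv e n x) : Module.End k (MvPolynomial ι k))

theorem leftInvSeries_commutator [CharZero k] (x z : L) :
    leftInvSeries e x * leftInvSeries e z - leftInvSeries e z * leftInvSeries e x =
      PowerSeries.X * leftInvSeries e ⁅x, z⁆ := by
  have key : ∀ (n : ℕ) (f : MvPolynomial ι k),
      PowerSeries.coeff n (leftInvSeries e x * leftInvSeries e z -
        leftInvSeries e z * leftInvSeries e x) f =
      vectorField e (∑ ij ∈ antidiagonal n, (dirDeriv e (leftInv e ij.1 x) (leftInv e ij.2 z) -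
        dirDeriv e (leftInv e ij.2 z) (leftInv e ij.1 x))) f := by
    intro n f
    rw [map_sub, PowerSeries.coeff_mul, PowerSeries.coeff_mul,
      ← Finset.Nat.sum_antidiagonal_swap (f := fun p : ℕ × ℕ =>
        PowerSeries.coeff p.1 (leftInvSeries e z) * PowerSeries.coeff p.2 (leftInvSeries e x)),
      ← Finset.sum_sub_distrib, map_sum]
    simp only [coeff_leftInvSeries, LinearMap.sum_apply, LinearMap.sub_apply,
      Module.End.mul_apply, Prod.fst_swap, Prod.snd_swap, Derivation.coeFn_coe]
    rw [← Derivation.coeFnAddMonoidHom_apply, map_sum, Finset.sum_apply]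
    exact Finset.sum_congr rfl fun ij _ => vectorField_commutator e _ _ f
  refine PowerSeries.ext fun n => LinearMap.ext fun f => ?_
  rw [key]
  cases n with
  | zero =>
    rw [PowerSeries.coeff_zero_X_mul]
    simp [leftInv_zero]
  | succ n =>
    rw [sum_dirDeriv_leftInv, PowerSeries.coeff_succ_X_mul, coeff_leftInvSeries]
    rfl

theorem single_mul_comm {A : Type*} [Ring A] (n : ℤ) (f : LaurentSeries A) :
    HahnSeries.single n 1 * f = f * HahnSeries.single n 1 := by
  ext m
  rw [HahnSeries.coeff_single_mul, HahnSeries.coeff_mul_single, one_mul, mul_one]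

/-- A linear map `P` from a Lie algebra to an associative algebra which multiplies brackets by an
invertible element becomes a morphism of Lie algebras after division by that element. -/
def lieHomOfScaled {A : Type*} [Ring A] [Algebra k A] (P : L →ₗ[k] A) (s t : A)
    (hs : ∀ a, s * a = a * s) (hst : s * t = 1)
    (hP : ∀ x z, P x * P z - P z * P x = t * P ⁅x, z⁆) : L →ₗ⁅k⁆ A where
  toFun x := s * P x
  map_add' x y := by rw [map_add, mul_add]
  map_smul' c x := by rw [map_smul, mul_smul_comm, RingHom.id_apply]
  map_lie' {x z} := by
    have comm : ∀ a b : A, s * a * (s * b) = s * (s * (a * b)) := fun a b => by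
      rw [mul_assoc, ← mul_assoc a s b, ← hs, mul_assoc]
    rw [LieRing.of_associative_ring_bracket, comm, comm, ← mul_sub, ← mul_sub, hP,
      ← mul_assoc s t, hst, one_mul]

/-- The representation of `L` by left-invariant vector fields in exponential coordinates: the
part of degree `n - 1` of the operator attached to `x` is `vectorField e (leftInv e n x)`. -/
noncomputable def formalRep [CharZero k] : L →ₗ⁅k⁆ FormalOp k ι :=
  lieHomOfScaled ((HahnSeries.ofPowerSeriesAlg ℤ k).toLinearMap ∘ₗ leftInvSeries e)
    (HahnSeries.single (-1) 1) (HahnSeries.single 1 1) (single_mul_comm _)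
    (by rw [HahnSeries.single_mul_single]; simp) fun x z => by
      have h := congrArg (HahnSeries.ofPowerSeries ℤ _) (leftInvSeries_commutator e x z)
      rw [map_sub, map_mul, map_mul, map_mul, HahnSeries.ofPowerSeries_X] at h
      exact h

theorem coeff_formalRep [CharZero k] (x : L) (n : ℤ) : (formalRep e x).coeff (n - 1) =
    (HahnSeries.ofPowerSeries ℤ _ (leftInvSeries e x)).coeff n := by
  change (HahnSeries.single (-1) 1 * HahnSeries.ofPowerSeries ℤ _ (leftInvSeries e x)).coeff _ = _
  rw [HahnSeries.coeff_single_mul, one_mul]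
  congr 1
  ring

theorem ofPowerSeries_coeff_neg {A : Type*} [Semiring A] (f : PowerSeries A) {n : ℤ} (h : n < 0) :
    (HahnSeries.ofPowerSeries ℤ A f).coeff n = 0 := by
  rw [HahnSeries.ofPowerSeries_apply, HahnSeries.embDomain_of_notMem_range]
  rintro ⟨m, hm⟩
  have : (m : ℤ) = n := hm
  omega

theorem coeff_neg_one_formalRep [CharZero k] (x : L) : (formalRep e x).coeff (-1) =
    (vectorField e (1 ⊗ₜ x) : Module.End k (MvPolynomial ι k)) := by
  have h := coeff_formalRep e x 0
  rw [zero_sub] at h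
  rw [h, ← Nat.cast_zero, HahnSeries.ofPowerSeries_apply_coeff, coeff_leftInvSeries, leftInv_zero]

/-- Equivariance of `formalRep`, as a relation between operators. -/
theorem C_vectorField_commutator_formalRep [CharZero k] (x z : L) :
    HahnSeries.C (vectorField e (LieAlgebra.ad k _ (1 ⊗ₜ x) (idPoly e)) :
        Module.End k (MvPolynomial ι k)) * formalRep e z -
      formalRep e z * HahnSeries.C (vectorField e (LieAlgebra.ad k _ (1 ⊗ₜ x) (idPoly e)) :
        Module.End k (MvPolynomial ι k)) = -formalRep e ⁅x, z⁆ := by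
  refine HahnSeries.ext (funext fun m => LinearMap.ext fun f => ?_)
  obtain ⟨n, rfl⟩ : ∃ n, m = n - 1 := ⟨m + 1, by ring⟩
  rw [HahnSeries.coeff_sub, HahnSeries.coeff_neg, HahnSeries.C_apply,
    HahnSeries.coeff_single_zero_mul, HahnSeries.coeff_mul_single_zero, coeff_formalRep,
    coeff_formalRep]
  obtain hn | hn := lt_or_ge n 0
  · simp [ofPowerSeries_coeff_neg _ hn]
  · obtain ⟨n, rfl⟩ := Int.eq_ofNat_of_zero_le hn
    rw [HahnSeries.ofPowerSeries_apply_coeff, HahnSeries.ofPowerSeries_apply_coeff,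
      coeff_leftInvSeries, coeff_leftInvSeries]
    have h := vectorField_commutator e (LieAlgebra.ad k _ (1 ⊗ₜ x) (idPoly e)) (leftInv e n z) f
    rw [dirDeriv_ad_leftInv, map_neg] at h
    rw [LinearMap.sub_apply]
    exact h

end Representation

/-! ### The equivariant retraction -/

section Retraction

attribute [local instance 100] LieRing.ofAssociativeRing

theorem rTensor_ad_one_tmul {k L R : Type*} [Field k] [LieRing L] [LieAlgebra k L]
    [CommRing R] [Algebra k R] (f : Module.End k R) (x : L) (w : R ⊗[k] L) :
    f.rTensor L (LieAlgebra.ad k _ (1 ⊗ₜ x) w) = LieAlgebra.ad k _ (1 ⊗ₜ x) (f.rTensor L w) := by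
  induction w with
  | zero => simp
  | add v w h h' => simp only [map_add, h, h']
  | tmul a y => simp [LieAlgebra.ad_apply]

variable {k : Type*} [Field k] [CharZero k] {L : Type*} [LieRing L] [LieAlgebra k L] {ι : Type*}
  [Fintype ι] (e : Module.Basis ι k L)

theorem C_vectorField_commutator (x : L) (u : UniversalEnvelopingAlgebra k L) :
    HahnSeries.C (vectorField e (LieAlgebra.ad k _ (1 ⊗ₜ x) (idPoly e)) :
        Module.End k (MvPolynomial ι k)) * UniversalEnvelopingAlgebra.lift k (formalRep e) u -
      UniversalEnvelopingAlgebra.lift k (formalRep e) u *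
        HahnSeries.C (vectorField e (LieAlgebra.ad k _ (1 ⊗ₜ x) (idPoly e)) :
          Module.End k (MvPolynomial ι k)) =
      -UniversalEnvelopingAlgebra.lift k (formalRep e) ⁅x, u⁆ := by
  refine algHom_commutator (UniversalEnvelopingAlgebra.lift k (formalRep e)) _ x (fun z => ?_) u
  rw [UniversalEnvelopingAlgebra.lift_ι_apply, UniversalEnvelopingAlgebra.lift_ι_apply]
  exact C_vectorField_commutator_formalRep e x z

/-- An `L`-equivariant retraction of `L → U(L)`: let `u` act through the left-invariant vector
fields on the identity map of `L`, and evaluate at the origin. The operator of degree `-1` is the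
one that turns the identity map into a constant. -/
noncomputable def retraction : UniversalEnvelopingAlgebra k L →ₗ⁅k,L⁆ L where
  toFun u := evalZero k L ι
    (((UniversalEnvelopingAlgebra.lift k (formalRep e) u).coeff (-1)).rTensor L (idPoly e))
  map_add' u v := by
    rw [map_add, HahnSeries.coeff_add, LinearMap.rTensor_add, LinearMap.add_apply, map_add]
  map_smul' c u := by
    rw [map_smul, HahnSeries.coeff_smul, LinearMap.rTensor_smul, LinearMap.smul_apply, map_smul,
      RingHom.id_apply]
  map_lie' {x u} := by
    have h := congrArg (fun a => evalZero k L ι ((HahnSeries.coeff a (-1)).rTensor L (idPoly e)))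
      (C_vectorField_commutator e x u)
    simp only [HahnSeries.coeff_sub, HahnSeries.coeff_neg, HahnSeries.C_apply,
      HahnSeries.coeff_single_zero_mul, HahnSeries.coeff_mul_single_zero, LinearMap.rTensor_sub,
      LinearMap.sub_apply, LinearMap.rTensor_neg, LinearMap.neg_apply, map_sub, map_neg,
      LinearMap.rTensor_mul, Module.End.mul_apply] at h
    -- The vector field `Y ↦ [x, Y]` vanishes at the origin.
    have h0 : ∀ w, evalZero k L ι ((vectorField e (LieAlgebra.ad k _ (1 ⊗ₜ x) (idPoly e)) :
        Module.End k (MvPolynomial ι k)).rTensor L w) = 0 :=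
      evalZero_dirDeriv e (by rw [evalZero_ad_one_tmul, evalZero_idPoly, lie_zero])
    have h1 : (vectorField e (LieAlgebra.ad k _ (1 ⊗ₜ x) (idPoly e)) :
        Module.End k (MvPolynomial ι k)).rTensor L (idPoly e) =
          LieAlgebra.ad k _ (1 ⊗ₜ x) (idPoly e) := dirDeriv_idPoly e _
    rw [h0, h1, rTensor_ad_one_tmul, evalZero_ad_one_tmul, zero_sub] at h
    exact (neg_injective h).symm

theorem retraction_toU (x : L) : retraction e (toU k L x) = x := by
  change evalZero k L ι (((UniversalEnvelopingAlgebra.lift k (formalRep e)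
    (UniversalEnvelopingAlgebra.ι k x)).coeff (-1)).rTensor L (idPoly e)) = x
  rw [UniversalEnvelopingAlgebra.lift_ι_apply, coeff_neg_one_formalRep, ← extendScalarsDer_apply]
  change evalZero k L ι (dirDeriv e _ (idPoly e)) = x
  rw [dirDeriv_idPoly]
  simp

theorem exists_retraction (k : Type*) (L : Type*) [Field k] [CharZero k] [LieRing L]
    [LieAlgebra k L] [FiniteDimensional k L] :
    ∃ r : UniversalEnvelopingAlgebra k L →ₗ⁅k,L⁆ L, Function.LeftInverse r (toU k L) :=
  ⟨retraction (Module.finBasis k L), retraction_toU _⟩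

end Retraction

/-! ### Retracts of Lie modules -/

section Functoriality

variable {k L M N : Type*} [CommRing k] [LieRing L] [LieAlgebra k L]
  [AddCommGroup M] [Module k M] [LieRingModule L M] [LieModule k L M]
  [AddCommGroup N] [Module k N] [LieRingModule L N] [LieModule k L N]
  {f : M →ₗ⁅k,L⁆ N} {r : N →ₗ⁅k,L⁆ M}

theorem derMap_leftInverse (h : Function.LeftInverse r f) :
    Function.LeftInverse (derMap r) (derMap f) := fun D =>
  LieDerivation.ext fun g => h (D g)

theorem adMap_leftInverse (h : Function.LeftInverse r f) :
    Function.LeftInverse (adMap r) (adMap f) := fun D =>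
  Subtype.ext (derMap_leftInverse h D)

theorem aidMap_leftInverse (h : Function.LeftInverse r f) :
    Function.LeftInverse (aidMap r) (aidMap f) := fun D =>
  Subtype.ext (derMap_leftInverse h D)

theorem outMap_leftInverse (h : Function.LeftInverse r f) :
    Function.LeftInverse (outMap r) (outMap f) := fun q => by
  obtain ⟨D, rfl⟩ := Submodule.Quotient.mk_surjective _ q
  exact congrArg (Submodule.Quotient.mk (p := ad k L M)) (derMap_leftInverse h D)

theorem shaMap_leftInverse (h : Function.LeftInverse r f) :
    Function.LeftInverse (shaMap r) (shaMap f) := fun q => by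
  obtain ⟨D, rfl⟩ := Submodule.Quotient.mk_surjective _ q
  exact congrArg (Submodule.Quotient.mk (p := (ad k L M).submoduleOf (AID k L M)))
    (aidMap_leftInverse h D)

end Functoriality

/-! ### An almost inner derivation that is not inner -/

/-- The five-dimensional filiform Lie algebra with basis `x₀, …, x₄` and nonzero brackets
`[x₀, x₁] = x₂`, `[x₀, x₂] = x₃`, `[x₀, x₃] = x₄`, `[x₁, x₂] = x₄`. -/
def Filiform (k : Type u) : Type u := Fin 5 → k

namespace Filiform

variable (k : Type u)

section

variable [Field k]

instance : AddCommGroup (Filiform k) := inferInstanceAs (AddCommGroup (Fin 5 → k))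

instance : Module k (Filiform k) := inferInstanceAs (Module k (Fin 5 → k))

instance : FiniteDimensional k (Filiform k) := inferInstanceAs (FiniteDimensional k (Fin 5 → k))

end

variable {k}

/-- The element `a₀ x₀ + … + a₄ x₄`. -/
def mk (a₀ a₁ a₂ a₃ a₄ : k) : Filiform k := ![a₀, a₁, a₂, a₃, a₄]

@[simp] theorem mk_zero (a₀ a₁ a₂ a₃ a₄ : k) : mk a₀ a₁ a₂ a₃ a₄ 0 = a₀ := rfl

@[simp] theorem mk_one (a₀ a₁ a₂ a₃ a₄ : k) : mk a₀ a₁ a₂ a₃ a₄ 1 = a₁ := rfl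

@[simp] theorem mk_two (a₀ a₁ a₂ a₃ a₄ : k) : mk a₀ a₁ a₂ a₃ a₄ 2 = a₂ := rfl

@[simp] theorem mk_three (a₀ a₁ a₂ a₃ a₄ : k) : mk a₀ a₁ a₂ a₃ a₄ 3 = a₃ := rfl

@[simp] theorem mk_four (a₀ a₁ a₂ a₃ a₄ : k) : mk a₀ a₁ a₂ a₃ a₄ 4 = a₄ := rfl

@[ext]
theorem ext {x y : Filiform k} (h : ∀ i, x i = y i) : x = y := funext h

variable [Field k]

@[simp] theorem add_apply (x y : Filiform k) (i : Fin 5) : (x + y) i = x i + y i := rfl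

@[simp] theorem smul_apply (c : k) (x : Filiform k) (i : Fin 5) : (c • x) i = c * x i := rfl

@[simp] theorem zero_apply (i : Fin 5) : (0 : Filiform k) i = 0 := rfl

@[simp] theorem sub_apply (x y : Filiform k) (i : Fin 5) : (x - y) i = x i - y i := rfl

instance : Bracket (Filiform k) (Filiform k) where
  bracket x y := mk 0 0 (x 0 * y 1 - x 1 * y 0) (x 0 * y 2 - x 2 * y 0)
    (x 0 * y 3 - x 3 * y 0 + (x 1 * y 2 - x 2 * y 1))

theorem lie_def (x y : Filiform k) : ⁅x, y⁆ =
    mk 0 0 (x 0 * y 1 - x 1 * y 0) (x 0 * y 2 - x 2 * y 0)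
    (x 0 * y 3 - x 3 * y 0 + (x 1 * y 2 - x 2 * y 1)) := rfl

instance : LieRing (Filiform k) where
  add_lie x y z := by ext i; fin_cases i <;> simp [lie_def] <;> ring
  lie_add x y z := by ext i; fin_cases i <;> simp [lie_def] <;> ring
  lie_self x := by ext i; fin_cases i <;> simp [lie_def] <;> ring
  leibniz_lie x y z := by ext i; fin_cases i <;> simp [lie_def] <;> ring

instance : LieAlgebra k (Filiform k) where
  lie_smul c x y := by ext i; fin_cases i <;> simp [lie_def] <;> ring

variable (k) in
/-- The derivation sending `x₁` to `x₄` and the other basis vectors to `0`. -/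
def outerDer : Der k (Filiform k) (Filiform k) where
  toFun x := mk 0 0 0 0 (x 1)
  map_add' x y := by ext i; fin_cases i <;> simp
  map_smul' c x := by ext i; fin_cases i <;> simp
  leibniz' x y := by
    change mk 0 0 0 0 (⁅x, y⁆ 1) = ⁅x, mk 0 0 0 0 (y 1)⁆ - ⁅y, mk 0 0 0 0 (x 1)⁆
    ext i; fin_cases i <;> simp [lie_def]

theorem outerDer_apply (x : Filiform k) : outerDer k x = mk 0 0 0 0 (x 1) := rfl

/-- `outerDer k x = [x, m]` with `m = x₂` if `x` has no component along `x₀`, and with `m` a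
multiple of `x₃` otherwise. -/
theorem outerDer_mem_AID : outerDer k ∈ AID k (Filiform k) (Filiform k) := by
  intro x
  by_cases h0 : x 0 = 0
  · refine ⟨mk 0 0 1 0 0, ?_⟩
    ext i; fin_cases i <;> simp [outerDer_apply, lie_def, h0]
  · refine ⟨mk 0 0 0 (x 1 / x 0) 0, ?_⟩
    ext i; fin_cases i <;> simp [outerDer_apply, lie_def]
    field_simp

/-- If `outerDer k` were `x ↦ [x, m]`, its value at `x₀` would force `m` to have no component along
`x₂`, and its value at `x₁` would force that component to be `1`. -/
theorem outerDer_notMem_ad : outerDer k ∉ ad k (Filiform k) (Filiform k) := by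
  intro h
  obtain ⟨m, hm⟩ := (mem_ad k _ _).1 h
  have h2 := congrFun (hm (mk 1 0 0 0 0)) 3
  have h4 := congrFun (hm (mk 0 1 0 0 0)) 4
  simp [outerDer_apply, lie_def] at h2 h4
  exact one_ne_zero (h4.trans h2.symm)

theorem nontrivial_sha : Nontrivial (Sha k (Filiform k) (Filiform k)) := by
  refine Submodule.Quotient.nontrivial_iff.2 fun h => outerDer_notMem_ad (k := k) ?_
  have : (⟨outerDer k, outerDer_mem_AID⟩ : AID k (Filiform k) (Filiform k)) ∈
    (ad k (Filiform k) (Filiform k)).submoduleOf (AID k (Filiform k) (Filiform k)) :=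
    h ▸ Submodule.mem_top
  exact this

end Filiform

/-! ### Nonvanishing for the enveloping algebra -/

theorem nontrivial_sha_U {k : Type*} {L : Type*} [Field k] [CharZero k] [LieRing L]
    [LieAlgebra k L] [FiniteDimensional k L] (h : Nontrivial (Sha k L L)) :
    Nontrivial (Sha k L (UniversalEnvelopingAlgebra k L)) :=
  let ⟨_, hr⟩ := exists_retraction k L
  (shaMap_leftInverse hr).injective.nontrivial

end LieSha

theorem proposition2p9 (k : Type u) [Field k] [CharZero k] :
    (∀ (𝔤 : Type v) [LieRing 𝔤] [LieAlgebra k 𝔤] [FiniteDimensional k 𝔤],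
      -- an element of `U(𝔤)` whose brackets with `𝔤` all lie in `𝔤` is in `𝔤` up to the centre
      (∀ m : UniversalEnvelopingAlgebra k 𝔤,
        (∀ g : 𝔤, ∃ x : 𝔤, ⁅g, m⁆ = LieSha.toU k 𝔤 x) →
          ∃ x : 𝔤, m - LieSha.toU k 𝔤 x ∈
            Subalgebra.center k (UniversalEnvelopingAlgebra k 𝔤)) ∧
      -- the five maps induced by `𝔤 → U(𝔤)`
      Function.Injective (LieSha.derMap (LieSha.toU k 𝔤)) ∧
      Function.Injective (LieSha.adMap (LieSha.toU k 𝔤)) ∧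
      Function.Injective (LieSha.outMap (LieSha.toU k 𝔤)) ∧
      Function.Injective (LieSha.aidMap (LieSha.toU k 𝔤)) ∧
      Function.Injective (LieSha.shaMap (LieSha.toU k 𝔤)) ∧
      -- nonvanishing
      (Nontrivial (LieSha.Sha k 𝔤 𝔤) →
        Nontrivial (LieSha.Sha k 𝔤 (UniversalEnvelopingAlgebra k 𝔤)))) ∧
    (∃ (𝔤 : Type u) (_ : LieRing 𝔤) (_ : LieAlgebra k 𝔤),
      FiniteDimensional k 𝔤 ∧
        Nontrivial (LieSha.Sha k 𝔤 (UniversalEnvelopingAlgebra k 𝔤))) := by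
  refine ⟨fun 𝔤 _ _ _ => ?_, LieSha.Filiform k, inferInstance, inferInstance, inferInstance,
    LieSha.nontrivial_sha_U LieSha.Filiform.nontrivial_sha⟩
  obtain ⟨r, hr⟩ := LieSha.exists_retraction k 𝔤
  refine ⟨fun m hm => ⟨r m, LieSha.mem_center_of_lie_eq_zero fun g => ?_⟩,
    (LieSha.derMap_leftInverse hr).injective, (LieSha.adMap_leftInverse hr).injective,
    (LieSha.outMap_leftInverse hr).injective, (LieSha.aidMap_leftInverse hr).injective,
    (LieSha.shaMap_leftInverse hr).injective, LieSha.nontrivial_sha_U⟩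
  -- If `[g, m] = i(y)`, then applying `r` gives `y = [g, r m]`.
  obtain ⟨y, hy⟩ := hm g
  have h : y = ⁅g, r m⁆ := by rw [← LieModuleHom.map_lie, hy, hr]
  rw [lie_sub, ← LieModuleHom.map_lie, hy, h, sub_self]
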